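/- Let $x,y\in M_n(\mathbb C)$ be Hermitian, let $t_1,t_2\in\mathbb R$, and for $t\in[t_1,t_2]$ let $x(t)$ be a Hermitian matrix with $$e^{ix(t)}=e^{itx}e^{iy}\qquad\text{and}\qquad \|x(t)\|_\infty<\frac{\pi}{2},$$ where $\|\cdot\|_\infty$ is the spectral (operator) norm; thus $ix(t)$ is the principal logarithm of the unitary matrix $e^{itx}e^{iy}$. Let $\|\cdot\|$ be a unitarily invariant norm on the real vector space $\mathfrak u(n)$ of skew-Hermitian $n\times n$ matrices, i.e. a norm with $\|UXV\|=\|X\|$ for all unitary $U,V$ and all $X\in\mathfrak u(n)$ such that $UXV\in\mathfrak u(n)$. Then, with $\|x(t)\|:=\|ix(t)\|$, the function $t\mapsto\|x(t)\|$ is convex on $[t_1,t_2]$. -/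

import Mathlib

open scoped Matrix.Norms.L2Operator

namespace UnitaryConvexity

/-- Complex `n × n` matrices; through the scoped instances opened above, `‖A‖` is the spectral
(operator) norm of `A`. -/
abbrev Mat (n : ℕ) : Type := Matrix (Fin n) (Fin n) ℂ

/-- The Lie algebra `u(n)` of skew-Hermitian matrices, as a real vector space. -/
abbrev LieU (n : ℕ) : Type := skewAdjoint (Mat n)

/-- The skew-Hermitian matrix `i z` attached to a Hermitian matrix `z`. -/
noncomputable def mulI {n : ℕ} (z : selfAdjoint (Mat n)) : LieU n :=
  ⟨Complex.I • (z : Mat n), z.2.smul_mem_skewAdjoint Complex.conj_I⟩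

/-- `N` is a unitarily invariant norm on the real vector space `u(n)`: it is a norm, and
`N (U X V) = N X` for all unitary `U`, `V` and all `X` in `u(n)` for which `U X V` is again in
`u(n)`. (`Seminorm` supplies the triangle inequality and absolute homogeneity over `ℝ`.) -/
structure IsUnitarilyInvariantNorm {n : ℕ} (N : Seminorm ℝ (LieU n)) : Prop where
  eq_zero_of_apply_eq_zero : ∀ X : LieU n, N X = 0 → X = 0
  invariant : ∀ U ∈ Matrix.unitaryGroup (Fin n) ℂ, ∀ V ∈ Matrix.unitaryGroup (Fin n) ℂ,
    ∀ X Y : LieU n, (Y : Mat n) = U * (X : Mat n) * V → N Y = N X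

end UnitaryConvexity

/-! Since the function is bounded above, midpoint convexity suffices. Put `E = exp (i (s - r) x /
2)`, and let `z` belong to the midpoint of `s` and `r`: the unitaries at `s` and `r` are `E exp (i
z)` and `Eᴴ exp (i z)`. In an eigenbasis of `z` with decreasing eigenvalues `θ`, `exp (i z)` is a
diagonal `D`, and the leading `k × k` blocks of `E D` and `Eᴴ D` have determinants with product
`|det E_k|² exp (2i (θ_1 + ⋯ + θ_k))`.

These blocks need not be unitary, but they are accretive, hence congruent to diagonal unitaries, and
their phases obey Cauchy-type interlacing (`HasPhases.compression_le`). The determinants give the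
phase sums modulo `2π`; induction on `k` removes the ambiguity (`sum_phases_add_sum_phases`). So
`2θ` is majorized by `φ + ψ`, the eigenvalue lists at `s` and `r`. The norm depends on eigenvalues
through a permutation invariant seminorm, which respects majorization (`seminorm_le_of_majorized`).
-/

namespace UnitaryConvexity

open Matrix Complex
open scoped ComplexOrder

/-! ### Phases of accretive matrices -/

/-- The spectral theorem with the eigenvalues listed in decreasing order. -/
theorem exists_antitone_eigenvalues {k : ℕ} {M : Mat k} (hM : M.IsHermitian) :
    ∃ U ∈ Matrix.unitaryGroup (Fin k) ℂ, ∃ l : Fin k → ℝ, Antitone l ∧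
      M = U * diagonal (fun j => (l j : ℂ)) * Uᴴ := by
  set σ := Tuple.sort (fun j => -hM.eigenvalues j) with hσ
  set V : Mat k := hM.eigenvectorUnitary.1 with hV
  have hVu : V * Vᴴ = 1 := Matrix.mem_unitaryGroup_iff.mp hM.eigenvectorUnitary.2
  have hspec : M = V * diagonal (fun j => (hM.eigenvalues j : ℂ)) * Vᴴ := by
    conv_lhs => rw [hM.spectral_theorem, Unitary.conjStarAlgAut_apply]
    rfl
  refine ⟨V.submatrix id σ, ?_, hM.eigenvalues ∘ σ, ?_, ?_⟩
  · rw [Matrix.mem_unitaryGroup_iff, star_eq_conjTranspose, conjTranspose_submatrix,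
      submatrix_mul_equiv, hVu, submatrix_id_id]
  · intro i j hij
    have := Tuple.monotone_sort (fun j => -hM.eigenvalues j) hij
    simpa using this
  · have : diagonal (fun j => (((hM.eigenvalues ∘ σ) j : ℝ) : ℂ)) =
        (diagonal (fun j => (hM.eigenvalues j : ℂ))).submatrix σ σ := by
      rw [submatrix_diagonal_equiv]; rfl
    rw [this, conjTranspose_submatrix, submatrix_mul_equiv, submatrix_mul_equiv, ← hspec,
      submatrix_id_id]

/-- `φ` is the decreasing list of phases of the accretive matrix `M`: up to congruence, `M` is
the diagonal unitary matrix with entries `exp (i φ j)`. -/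
def HasPhases {k : ℕ} (M : Mat k) (φ : Fin k → ℝ) : Prop :=
  Antitone φ ∧ (∀ j, |φ j| < Real.pi / 2) ∧
    ∃ T : Mat k, IsUnit T.det ∧ M = Tᴴ * diagonal (fun j => exp (φ j * I)) * T

theorem dotProduct_congr_diagonal {k : ℕ} (T : Mat k) (d v : Fin k → ℂ) :
    star v ⬝ᵥ ((Tᴴ * diagonal d * T) *ᵥ v) = ∑ j, (normSq ((T *ᵥ v) j) : ℂ) * d j := by
  rw [← mulVec_mulVec, ← mulVec_mulVec, dotProduct_mulVec, ← star_mulVec, dotProduct]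
  refine Finset.sum_congr rfl fun j _ => ?_
  rw [mulVec_diagonal, Pi.star_apply, ← mul_conj, starRingEnd_apply]
  ring

theorem mulVec_ne_zero_of_isUnit_det {k : ℕ} {T : Mat k} (hT : IsUnit T.det) {v : Fin k → ℂ}
    (hv : v ≠ 0) : T *ᵥ v ≠ 0 := fun h =>
  hv (Matrix.eq_zero_of_mulVec_eq_zero hT.ne_zero h)

/-- The quadratic form is a combination of the `exp (i φ j)`, all in the open right half-plane, with
nonnegative weights that do not all vanish. -/
theorem HasPhases.re_pos {k : ℕ} {M : Mat k} {φ : Fin k → ℝ} (h : HasPhases M φ)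
    {v : Fin k → ℂ} (hv : v ≠ 0) : 0 < (star v ⬝ᵥ (M *ᵥ v)).re := by
  obtain ⟨-, hφ, T, hT, rfl⟩ := h
  rw [dotProduct_congr_diagonal, re_sum]
  obtain ⟨i, hi⟩ := Function.ne_iff.mp (mulVec_ne_zero_of_isUnit_det hT hv)
  have hcos : ∀ j, 0 < Real.cos (φ j) := fun j =>
    Real.cos_pos_of_mem_Ioo ⟨(abs_lt.mp (hφ j)).1, (abs_lt.mp (hφ j)).2⟩
  have e : ∀ j, ((normSq ((T *ᵥ v) j) : ℂ) * exp (φ j * I)).re =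
      normSq ((T *ᵥ v) j) * Real.cos (φ j) := fun j => by
    rw [re_ofReal_mul, exp_ofReal_mul_I_re]
  simp only [e]
  exact Finset.sum_pos' (fun j _ => mul_nonneg (normSq_nonneg _) (hcos j).le)
    ⟨i, Finset.mem_univ _, mul_pos (normSq_pos.mpr hi) (hcos i)⟩

theorem ofReal_sqrt_one_add_sq_mul_exp_arctan (l : ℝ) :
    ((Real.sqrt (1 + l ^ 2) : ℝ) : ℂ) * exp (Real.arctan l * I) = 1 + l * I := by
  have h : 0 < Real.sqrt (1 + l ^ 2) := Real.sqrt_pos.mpr (by positivity)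
  apply Complex.ext
  · rw [re_ofReal_mul, exp_ofReal_mul_I_re, Real.cos_arctan]; simp [h.ne']
  · rw [im_ofReal_mul, exp_ofReal_mul_I_im, Real.sin_arctan]; simp; field_simp

/-- Accretive matrices have phases. -/
theorem exists_hasPhases {k : ℕ} (M : Mat k)
    (hM : ∀ v : Fin k → ℂ, v ≠ 0 → 0 < (star v ⬝ᵥ (M *ᵥ v)).re) : ∃ φ, HasPhases M φ := by
  -- Cartesian decomposition `M = P + iQ`; accretivity says exactly that `P` is positive definite.
  set P : Mat k := (1 / 2 : ℂ) • (M + Mᴴ) with hP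
  set Q : Mat k := (-(I / 2)) • (M - Mᴴ) with hQ
  have hMPQ : M = P + I • Q := by
    rw [hP, hQ, smul_smul]
    have : I * (-(I / 2)) = 1 / 2 := by linear_combination (-1 / 2 : ℂ) * I_mul_I
    rw [this, ← smul_add]
    ext i j
    simp
    ring
  have hPh : P.IsHermitian := by
    rw [Matrix.IsHermitian, hP, conjTranspose_smul, conjTranspose_add, conjTranspose_conjTranspose,
      add_comm]
    simp
  have hQh : Q.IsHermitian := by
    rw [Matrix.IsHermitian, hQ, conjTranspose_smul, conjTranspose_sub, conjTranspose_conjTranspose]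
    ext i j
    simp
    ring
  have hPpos : P.PosDef := by
    refine Matrix.PosDef.of_dotProduct_mulVec_pos hPh fun v hv => ?_
    have e : star v ⬝ᵥ (P *ᵥ v) = ((star v ⬝ᵥ (M *ᵥ v)).re : ℂ) := by
      have h1 : star v ⬝ᵥ (Mᴴ *ᵥ v) = star (star v ⬝ᵥ (M *ᵥ v)) := by
        rw [dotProduct_mulVec, ← star_mulVec, star_dotProduct]
      rw [hP, smul_mulVec, add_mulVec, dotProduct_smul, dotProduct_add, h1, re_eq_add_conj,
        starRingEnd_apply, smul_eq_mul]
      ring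
    rw [e]
    exact_mod_cast hM v hv
  open scoped MatrixOrder in
  obtain ⟨B, hB⟩ : ∃ B : Mat k, P = Bᴴ * B :=
    CStarAlgebra.nonneg_iff_eq_star_mul_self.mp hPpos.posSemidef.nonneg
  have hBdet : IsUnit B.det := by
    have := (Matrix.isUnit_iff_isUnit_det _).mp hPpos.isUnit
    rw [hB, det_mul] at this
    exact isUnit_of_mul_isUnit_right this
  have hBH : IsUnit Bᴴ.det := by rw [det_conjTranspose]; exact hBdet.star
  -- `P` and `Q` are diagonalized by one congruence: `M = Bᴴ W (1 + i diag l) Wᴴ B`.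
  obtain ⟨W, hW, l, hl, hWl⟩ := exists_antitone_eigenvalues
    (M := (B⁻¹)ᴴ * Q * B⁻¹) (isHermitian_conjTranspose_mul_mul _ hQh)
  have hWW : W * Wᴴ = 1 := Matrix.mem_unitaryGroup_iff.mp hW
  have hQB : Q = Bᴴ * (W * diagonal (fun j => (l j : ℂ)) * Wᴴ) * B := by
    rw [← hWl, conjTranspose_nonsing_inv]
    simp only [Matrix.mul_assoc]
    rw [nonsing_inv_mul _ hBdet, ← Matrix.mul_assoc Bᴴ, mul_nonsing_inv _ hBH]
    simp
  -- `1 + i l` has argument `arctan l` and modulus `√(1 + l²)`; each side of the congruence absorbs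
  -- a square root of the modulus.
  have hs : ∀ j, 0 < Real.sqrt (Real.sqrt (1 + l j ^ 2)) := fun j =>
    Real.sqrt_pos.mpr (Real.sqrt_pos.mpr (by positivity))
  refine ⟨fun j => Real.arctan (l j), fun i j hij => Real.arctan_strictMono.monotone (hl hij),
    fun j => abs_lt.mpr ⟨Real.neg_pi_div_two_lt_arctan _, Real.arctan_lt_pi_div_two _⟩,
    diagonal (fun j => ((Real.sqrt (Real.sqrt (1 + l j ^ 2)) : ℝ) : ℂ)) * Wᴴ * B, ?_, ?_⟩
  · rw [det_mul, det_mul, det_diagonal]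
    refine (IsUnit.mul ?_ ?_).mul hBdet
    · rw [isUnit_iff_ne_zero, Finset.prod_ne_zero_iff]
      intro j _
      exact_mod_cast (hs j).ne'
    · have := congrArg det hWW
      rw [det_mul, det_one] at this
      exact IsUnit.of_mul_eq_one _ ((mul_comm _ _).trans this)
  · have hd : diagonal (fun j => ((Real.sqrt (Real.sqrt (1 + l j ^ 2)) : ℝ) : ℂ)) *
        diagonal (fun j => exp (Real.arctan (l j) * I)) *
        diagonal (fun j => ((Real.sqrt (Real.sqrt (1 + l j ^ 2)) : ℝ) : ℂ)) =
        (1 : Mat k) + I • diagonal (fun j => (l j : ℂ)) := by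
      rw [diagonal_mul_diagonal, diagonal_mul_diagonal, ← diagonal_one, ← diagonal_smul,
        diagonal_add]
      congr 1
      funext j
      have h2 := ofReal_sqrt_one_add_sq_mul_exp_arctan (l j)
      rw [← Real.mul_self_sqrt (Real.sqrt_nonneg (1 + l j ^ 2)), ofReal_mul] at h2
      simp only [Pi.smul_apply, smul_eq_mul]
      rw [mul_comm I, ← h2]
      ring
    have hdH : (diagonal (fun j => ((Real.sqrt (Real.sqrt (1 + l j ^ 2)) : ℝ) : ℂ)))ᴴ =
        (diagonal (fun j => ((Real.sqrt (Real.sqrt (1 + l j ^ 2)) : ℝ) : ℂ))) := by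
      rw [diagonal_conjTranspose]
      congr 1
      funext j
      simp
    rw [conjTranspose_mul, conjTranspose_mul, conjTranspose_conjTranspose, hdH]
    calc M = Bᴴ * (W * ((1 : Mat k) + I • diagonal (fun j => (l j : ℂ))) * Wᴴ) * B := by
          conv_lhs => rw [hMPQ, hB, hQB]
          rw [Matrix.mul_add, Matrix.add_mul, Matrix.mul_one, hWW, Matrix.mul_add, Matrix.add_mul,
            Matrix.mul_one]
          simp only [Matrix.mul_smul, Matrix.smul_mul]
      _ = _ := by
          rw [← hd]
          simp only [Matrix.mul_assoc]

/-! ### Interlacing of phases under compression -/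

/-- Compressing an accretive matrix to a subspace does not increase its phases. -/
theorem HasPhases.compression_le {n k : ℕ} {M : Mat n} {φ : Fin n → ℝ} (h : HasPhases M φ)
    {X : Matrix (Fin n) (Fin k) ℂ} (hX : ∀ v, v ≠ 0 → X *ᵥ v ≠ 0) {ψ : Fin k → ℝ}
    (h' : HasPhases (Xᴴ * M * X) ψ) (hk : k ≤ n) (j : Fin k) :
    ψ j ≤ φ (Fin.castLE hk j) := by
  obtain ⟨hφm, hφ, T, hT, rfl⟩ := h
  obtain ⟨hψm, hψ, R, hR, hM⟩ := h'
  by_contra! hlt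
  -- The zero row `j` makes `Z` singular. A kernel vector `v` kills the coordinates of `T X v`
  -- before `j` and those of `R v` after `j`.
  set Z : Mat k := fun i => if i < j then (T * X) (Fin.castLE hk i) else if i = j then 0 else R i
    with hZ
  have hZdet : Z.det = 0 := by
    apply det_eq_zero_of_row_eq_zero j
    intro i
    simp [hZ]
  obtain ⟨v, hv, hZv⟩ := exists_mulVec_eq_zero_iff.mpr hZdet
  have hlow : ∀ i : Fin n, i < Fin.castLE hk j → (T *ᵥ (X *ᵥ v)) i = 0 := by
    intro i hi
    have hij : (i : ℕ) < j := hi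
    have h1 := congrFun hZv ⟨i, hij.trans j.2⟩
    have h2 : (⟨i, hij.trans j.2⟩ : Fin k) < j := hi
    rw [mulVec_mulVec]
    simpa [mulVec, hZ, h2] using h1
  have hhigh : ∀ i : Fin k, j < i → (R *ᵥ v) i = 0 := by
    intro i hi
    have h1 := congrFun hZv i
    simpa [mulVec, hZ, hi.not_gt, hi.ne'] using h1
  have key : ∑ i, (normSq ((R *ᵥ v) i) : ℂ) * exp (ψ i * I) =
      ∑ i, (normSq ((T *ᵥ (X *ᵥ v)) i) : ℂ) * exp (φ i * I) := by
    rw [← dotProduct_congr_diagonal, ← dotProduct_congr_diagonal, ← hM, ← mulVec_mulVec,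
      ← mulVec_mulVec, dotProduct_mulVec, ← star_mulVec]
  -- Rotating by `exp (-i ψ j)` and taking imaginary parts yields opposite signs: the surviving
  -- phases have `ψ i ≥ ψ j` on the left and `φ i ≤ φ j < ψ j` on the right, with all differences
  -- inside `(-π, π)`.
  have key2 : ∑ i, normSq ((R *ᵥ v) i) * Real.sin (ψ i - ψ j) =
      ∑ i, normSq ((T *ᵥ (X *ᵥ v)) i) * Real.sin (φ i - ψ j) := by
    have e : ∀ (c a : ℝ), (((c : ℂ) * exp (a * I)) * exp ((-ψ j : ℝ) * I)).im =
        c * Real.sin (a - ψ j) := fun c a => by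
      rw [mul_assoc, ← Complex.exp_add, ← add_mul, ← ofReal_add, im_ofReal_mul,
        exp_ofReal_mul_I_im, sub_eq_add_neg]
    have := congrArg (fun w => (w * exp ((-ψ j : ℝ) * I)).im) key
    simpa only [Finset.sum_mul, im_sum, e] using this
  have hl : 0 ≤ ∑ i, normSq ((R *ᵥ v) i) * Real.sin (ψ i - ψ j) := by
    refine Finset.sum_nonneg fun i _ => ?_
    rcases lt_or_ge j i with hi | hi
    · simp [hhigh i hi]
    · have h1 := hψm hi
      have h2 := abs_lt.mp (hψ i)
      have h3 := abs_lt.mp (hψ j)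
      exact mul_nonneg (normSq_nonneg _)
        (Real.sin_nonneg_of_nonneg_of_le_pi (by linarith) (by linarith))
  obtain ⟨i₀, hi₀⟩ := Function.ne_iff.mp (mulVec_ne_zero_of_isUnit_det hT (hX v hv))
  have hsin : ∀ i : Fin n, Fin.castLE hk j ≤ i → Real.sin (φ i - ψ j) < 0 := fun i hi => by
    have h1 := hφm hi
    have h2 := abs_lt.mp (hφ i)
    have h3 := abs_lt.mp (hψ j)
    exact Real.sin_neg_of_neg_of_neg_pi_lt (by linarith) (by linarith)
  have hr : ∑ i, normSq ((T *ᵥ (X *ᵥ v)) i) * Real.sin (φ i - ψ j) < 0 := by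
    refine Finset.sum_neg' (fun i _ => ?_) ⟨i₀, Finset.mem_univ _, ?_⟩
    · rcases lt_or_ge i (Fin.castLE hk j) with hi | hi
      · simp [hlow i hi]
      · exact mul_nonpos_of_nonneg_of_nonpos (normSq_nonneg _) (hsin i hi).le
    · rcases lt_or_ge i₀ (Fin.castLE hk j) with hi | hi
      · exact absurd (hlow i₀ hi) hi₀
      · exact mul_neg_of_pos_of_neg (normSq_pos.mpr hi₀) (hsin i₀ hi)
  linarith

/-- The adjoint negates phases, and `rev` restores decreasing order. This turns upper interlacing
bounds into lower ones. -/
theorem HasPhases.conjTranspose {k : ℕ} {M : Mat k} {φ : Fin k → ℝ} (h : HasPhases M φ) :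
    HasPhases Mᴴ (fun j => -φ j.rev) := by
  obtain ⟨hφm, hφ, T, hT, rfl⟩ := h
  refine ⟨fun i j hij => neg_le_neg (hφm (Fin.rev_le_rev.mpr hij)), fun j => by
    rw [abs_neg]; exact hφ _, T.submatrix Fin.revPerm id, ?_, ?_⟩
  · rw [det_permute]
    exact ((Units.isUnit _).map (Int.castRingHom ℂ)).mul hT
  · have : diagonal (fun j => exp (((-φ j.rev : ℝ) : ℂ) * I)) =
        (diagonal (fun j => exp (((-φ j : ℝ) : ℂ) * I))).submatrix Fin.revPerm Fin.revPerm := by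
      rw [submatrix_diagonal_equiv]; rfl
    rw [this, conjTranspose_submatrix, submatrix_mul_equiv, submatrix_mul_equiv, submatrix_id_id,
      conjTranspose_mul, conjTranspose_mul, conjTranspose_conjTranspose, diagonal_conjTranspose,
      Matrix.mul_assoc]
    congr 3
    funext j
    simp [← Complex.exp_conj]

/-- Lower half of the interlacing inequalities for the phases of a compression. -/
theorem HasPhases.le_compression {n k : ℕ} {M : Mat n} {φ : Fin n → ℝ} (h : HasPhases M φ)
    {X : Matrix (Fin n) (Fin k) ℂ} (hX : ∀ v, v ≠ 0 → X *ᵥ v ≠ 0) {ψ : Fin k → ℝ}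
    (h' : HasPhases (Xᴴ * M * X) ψ) (hk : k ≤ n) (j : Fin k) :
    φ (Fin.castLE hk j.rev).rev ≤ ψ j := by
  have h1 := h'.conjTranspose
  rw [conjTranspose_mul, conjTranspose_mul, conjTranspose_conjTranspose, ← Matrix.mul_assoc] at h1
  have := h.conjTranspose.compression_le hX h1 hk j.rev
  simpa using this

theorem HasPhases.exists_compression {n k : ℕ} {M : Mat n} {φ : Fin n → ℝ} (h : HasPhases M φ)
    {X : Matrix (Fin n) (Fin k) ℂ} (hX : ∀ v, v ≠ 0 → X *ᵥ v ≠ 0) :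
    ∃ ψ, HasPhases (Xᴴ * M * X) ψ := by
  refine exists_hasPhases _ fun v hv => ?_
  rw [← mulVec_mulVec, ← mulVec_mulVec, dotProduct_mulVec, ← star_mulVec]
  exact h.re_pos (hX v hv)

theorem HasPhases.det_eq {k : ℕ} {M : Mat k} {φ : Fin k → ℝ} (h : HasPhases M φ) :
    ∃ r : ℝ, 0 < r ∧ M.det = r * exp ((∑ j, φ j : ℝ) * I) := by
  obtain ⟨-, -, T, hT, rfl⟩ := h
  refine ⟨normSq T.det, normSq_pos.mpr hT.ne_zero, ?_⟩
  rw [det_mul, det_mul, det_diagonal, det_conjTranspose, ofReal_sum, Finset.sum_mul,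
    Complex.exp_sum, ← mul_conj, starRingEnd_apply]
  ring

theorem submatrix_castLE_eq_compression {n k : ℕ} (M : Mat n) (hk : k ≤ n) :
    M.submatrix (Fin.castLE hk) (Fin.castLE hk) =
      ((1 : Mat n).submatrix id (Fin.castLE hk))ᴴ * M * (1 : Mat n).submatrix id (Fin.castLE hk) := by
  rw [conjTranspose_submatrix, conjTranspose_one]
  ext i j
  simp [Matrix.mul_apply, Matrix.one_apply]

theorem submatrix_one_castLE_mulVec_ne_zero {n k : ℕ} (hk : k ≤ n) (v : Fin k → ℂ) (hv : v ≠ 0) :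
    (1 : Mat n).submatrix id (Fin.castLE hk) *ᵥ v ≠ 0 := by
  obtain ⟨j, hj⟩ := Function.ne_iff.mp hv
  refine Function.ne_iff.mpr ⟨Fin.castLE hk j, ?_⟩
  simpa [mulVec, dotProduct, Matrix.one_apply] using hj

theorem HasPhases.exists_submatrix {n k : ℕ} {M : Mat n} {φ : Fin n → ℝ} (h : HasPhases M φ)
    (hk : k ≤ n) : ∃ ψ, HasPhases (M.submatrix (Fin.castLE hk) (Fin.castLE hk)) ψ := by
  rw [submatrix_castLE_eq_compression]
  exact h.exists_compression (submatrix_one_castLE_mulVec_ne_zero hk)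

theorem HasPhases.submatrix_le {n k : ℕ} {M : Mat n} {φ : Fin n → ℝ} (h : HasPhases M φ)
    (hk : k ≤ n) {ψ : Fin k → ℝ}
    (h' : HasPhases (M.submatrix (Fin.castLE hk) (Fin.castLE hk)) ψ) (j : Fin k) :
    ψ j ≤ φ (Fin.castLE hk j) := by
  rw [submatrix_castLE_eq_compression] at h'
  exact h.compression_le (submatrix_one_castLE_mulVec_ne_zero hk) h' hk j

theorem HasPhases.le_submatrix {n k : ℕ} {M : Mat n} {φ : Fin n → ℝ} (h : HasPhases M φ)
    (hk : k ≤ n) {ψ : Fin k → ℝ}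
    (h' : HasPhases (M.submatrix (Fin.castLE hk) (Fin.castLE hk)) ψ) (j : Fin k) :
    φ (Fin.castLE hk j.rev).rev ≤ ψ j := by
  rw [submatrix_castLE_eq_compression] at h'
  exact h.le_compression (submatrix_one_castLE_mulVec_ne_zero hk) h' hk j

/-! ### Phase sums and determinants of leading blocks -/

/-- Passing to a leading block of corank one changes the sum of the phases by less than `π / 2`. -/
theorem HasPhases.abs_sum_sub_sum_lt {k : ℕ} {M : Mat (k + 1)} {φ : Fin (k + 1) → ℝ}
    (h : HasPhases M φ) {ψ : Fin k → ℝ}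
    (h' : HasPhases (M.submatrix (Fin.castLE k.le_succ) (Fin.castLE k.le_succ)) ψ) :
    |∑ j, φ j - ∑ j, ψ j| < Real.pi / 2 := by
  have h1 : ∑ j, ψ j ≤ ∑ j : Fin k, φ j.castSucc :=
    Finset.sum_le_sum fun j _ => h.submatrix_le k.le_succ h' j
  have h2 : ∑ j : Fin k, φ j.succ ≤ ∑ j, ψ j := Finset.sum_le_sum fun j _ => by
    have := h.le_submatrix k.le_succ h' j
    have e : (Fin.castLE k.le_succ j.rev).rev = j.succ := by
      ext
      simp only [Fin.val_rev, Fin.val_castLE, Fin.val_succ]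
      omega
    rwa [e] at this
  -- By interlacing, the difference of the sums lies between the smallest phase and the largest.
  have h3 := abs_lt.mp (h.2.1 0)
  have h4 := abs_lt.mp (h.2.1 (Fin.last k))
  have e1 := Fin.sum_univ_succ φ
  have e2 := Fin.sum_univ_castSucc φ
  rw [abs_lt]
  constructor <;> linarith

theorem eq_of_mul_exp_eq_mul_exp {c d a b : ℝ} (hc : 0 < c) (hd : 0 ≤ d)
    (h : (c : ℂ) * exp (a * I) = d * exp (b * I)) (hab : |a - b| < 2 * Real.pi) : a = b := by
  have hcd : c = d := by
    have := congrArg norm h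
    simpa [Complex.norm_exp_ofReal_mul_I, abs_of_pos hc, abs_of_nonneg hd] using this
  rw [hcd] at h
  have hd0 : (d : ℂ) ≠ 0 := by exact_mod_cast (hcd ▸ hc).ne'
  obtain ⟨m, hm⟩ := Complex.exp_eq_exp_iff_exists_int.mp (mul_left_cancel₀ hd0 h)
  have hm' : a = b + m * (2 * Real.pi) := by
    have := congrArg Complex.im hm
    simpa using this
  have hm0 : m = 0 := by
    have h1 : |(m : ℝ)| * (2 * Real.pi) < 1 * (2 * Real.pi) := by
      have : a - b = m * (2 * Real.pi) := by linarith
      rw [this, abs_mul, abs_of_pos Real.two_pi_pos] at hab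
      linarith
    have h2 := lt_of_mul_lt_mul_right h1 Real.two_pi_pos.le
    have h3 : |m| < 1 := by exact_mod_cast h2
    exact Int.abs_lt_one_iff.mp h3
  simpa [hm0] using hm'

/-- The sums of the phases of the leading blocks of `E D` and `Eᴴ D`, with `D` diagonal unitary,
add up to twice the partial sum of the phases of `D`. -/
theorem sum_phases_add_sum_phases {n : ℕ} (E : Mat n) {θ φ ψ : Fin n → ℝ}
    (hθ : ∀ j, |θ j| < Real.pi / 2)
    (hφ : HasPhases (E * diagonal (fun j => exp (θ j * I))) φ)
    (hψ : HasPhases (Eᴴ * diagonal (fun j => exp (θ j * I))) ψ) (k : ℕ) :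
    ∀ (hk : k ≤ n) (φ' ψ' : Fin k → ℝ),
      HasPhases ((E * diagonal (fun j => exp (θ j * I))).submatrix
        (Fin.castLE hk) (Fin.castLE hk)) φ' →
      HasPhases ((Eᴴ * diagonal (fun j => exp (θ j * I))).submatrix
        (Fin.castLE hk) (Fin.castLE hk)) ψ' →
      ∑ j, φ' j + ∑ j, ψ' j = 2 * ∑ j, θ (Fin.castLE hk j) := by
  induction k with
  | zero => intros; simp
  | succ k ih =>
    intro hk φ' ψ' hφ' hψ'
    obtain ⟨φ'', hφ''⟩ := hφ.exists_submatrix (k.le_succ.trans hk)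
    obtain ⟨ψ'', hψ''⟩ := hψ.exists_submatrix (k.le_succ.trans hk)
    have h0 := ih _ _ _ hφ'' hψ''
    have h1 := abs_lt.mp (hφ'.abs_sum_sub_sum_lt (ψ := φ'') hφ'')
    have h2 := abs_lt.mp (hψ'.abs_sum_sub_sum_lt (ψ := ψ'') hψ'')
    have h3 := abs_lt.mp (hθ (Fin.castLE hk (Fin.last k)))
    have e3 : ∑ j, θ (Fin.castLE hk j) =
        ∑ j, θ (Fin.castLE (k.le_succ.trans hk) j) + θ (Fin.castLE hk (Fin.last k)) :=
      Fin.sum_univ_castSucc _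
    have hdet : ∀ G : Mat n, ((G * diagonal (fun j => exp (θ j * I))).submatrix
        (Fin.castLE hk) (Fin.castLE hk)).det =
        (G.submatrix (Fin.castLE hk) (Fin.castLE hk)).det *
          exp ((∑ j, θ (Fin.castLE hk j) : ℝ) * I) := fun G => by
      have : (G * diagonal (fun j => exp (θ j * I))).submatrix (Fin.castLE hk) (Fin.castLE hk) =
          G.submatrix (Fin.castLE hk) (Fin.castLE hk) *
            diagonal (fun j => exp (θ (Fin.castLE hk j) * I)) := by
        ext i j
        simp [mul_diagonal]
      rw [this, det_mul, det_diagonal, ← Complex.exp_sum, ofReal_sum, Finset.sum_mul]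
    obtain ⟨r, hr, hr'⟩ := hφ'.det_eq
    obtain ⟨s, hs, hs'⟩ := hψ'.det_eq
    rw [hdet] at hr' hs'
    rw [show Eᴴ.submatrix (Fin.castLE hk) (Fin.castLE hk) =
      (E.submatrix (Fin.castLE hk) (Fin.castLE hk))ᴴ from rfl, det_conjTranspose] at hs'
    set δ := (E.submatrix (Fin.castLE hk) (Fin.castLE hk)).det
    -- Multiplying the two determinants cancels the argument of `δ`. From `k` to `k + 1` the
    -- discrepancy moves by less than `π/2 + π/2 + 2 · π/2 = 2π`, so it stays zero.
    refine eq_of_mul_exp_eq_mul_exp (mul_pos hr hs) (normSq_nonneg δ) ?_ ?_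
    · rw [← mul_conj, starRingEnd_apply, ofReal_mul, ofReal_add, add_mul, Complex.exp_add,
        ofReal_mul, ofReal_ofNat, mul_assoc 2, two_mul, Complex.exp_add]
      linear_combination (-(star δ * exp ((∑ j, θ (Fin.castLE hk j) : ℝ) * I))) * hr' -
        (r * exp ((∑ j, φ' j : ℝ) * I)) * hs'
    · rw [abs_lt]
      constructor <;> linarith

/-! ### Majorization -/

/-- Abel summation against a decreasing weight. -/
theorem mul_sum_le_sum_mul_of_antitone {n : ℕ} (c : ℝ) (d u : Fin n → ℝ) (hd : Antitone d)
    (hc : ∀ j, c ≤ d j)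
    (hu : ∀ (k : ℕ) (hk : k ≤ n), 0 ≤ ∑ j, u (Fin.castLE hk j)) :
    c * ∑ j, u j ≤ ∑ j, d j * u j := by
  induction n generalizing c with
  | zero => simp
  | succ n ih =>
    -- The last weight becomes the lower bound for the shorter list.
    have h1 := ih (d (Fin.last n)) (fun j => d j.castSucc) (fun j => u j.castSucc)
      (fun i j hij => hd (Fin.castSucc_le_castSucc_iff.mpr hij)) (fun j => hd (Fin.le_last _))
      (fun k hk => hu k (hk.trans n.le_succ))
    have h2 := mul_le_mul_of_nonneg_right (hc (Fin.last n)) (hu (n + 1) le_rfl)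
    simp only [Fin.castLE_rfl, id] at h2
    rw [Fin.sum_univ_castSucc (fun j => d j * u j)]
    rw [Fin.sum_univ_castSucc u] at h2 ⊢
    linarith

/-- A permutation invariant seminorm is monotone for majorization. -/
theorem seminorm_le_of_majorized {n : ℕ} (p : Seminorm ℝ (Fin n → ℝ))
    (hp : ∀ (σ : Equiv.Perm (Fin n)) v, p (v ∘ σ) = p v) {v w : Fin n → ℝ} (hv : Antitone v)
    (hle : ∀ (k : ℕ) (hk : k ≤ n), ∑ j, v (Fin.castLE hk j) ≤ ∑ j, w (Fin.castLE hk j))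
    (heq : ∑ j, v j = ∑ j, w j) : p v ≤ p w := by
  rcases eq_or_ne v 0 with rfl | hv0
  · simp
  -- Hahn–Banach: a linear `g ≤ p` with `g v = p v`.
  obtain ⟨g, hg, hgp⟩ := exists_extension_of_le_sublinear (LinearPMap.mkSpanSingleton v (p v) hv0) p
    (fun c hc x => by rw [map_smul_eq_mul, Real.norm_of_nonneg hc.le]) (fun x y => map_add_le_add p x y)
    (by
      rintro ⟨x, hx⟩
      obtain ⟨c, rfl⟩ := Submodule.mem_span_singleton.mp hx
      rw [LinearPMap.mkSpanSingleton'_apply, map_smul_eq_mul, smul_eq_mul]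
      exact mul_le_mul_of_nonneg_right (Real.le_norm_self c) (apply_nonneg p v))
  have hgv : g v = p v := by
    have := hg ⟨v, Submodule.mem_span_singleton_self v⟩
    rw [this]
    exact LinearPMap.mkSpanSingleton_apply ℝ ℝ hv0 _
  set d : Fin n → ℝ := fun j => g (Pi.single j 1) with hd
  have hgd : ∀ x, g x = ∑ j, d j * x j := fun x => by
    conv_lhs => rw [← Finset.univ_sum_single x, map_sum]
    refine Finset.sum_congr rfl fun j _ => ?_
    rw [hd, mul_comm, ← smul_eq_mul, ← map_smul, ← Pi.single_smul, smul_eq_mul, mul_one]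
  -- Sorting the coefficients of `g` can only increase the pairing with the decreasing `v`; on the
  -- `w` side the permutation is absorbed by invariance of `p`.
  set σ := Tuple.sort (fun j => -d j) with hσ
  have hdσ : Antitone (d ∘ σ) := fun i j hij => by
    simpa using Tuple.monotone_sort (fun j => -d j) hij
  have h1 : p v ≤ ∑ j, (d ∘ σ) j * v j := by
    have hm : Monovary (d ∘ σ) v := hdσ.monovary hv
    have := hm.sum_comp_perm_mul_le_sum_mul (σ := σ⁻¹)
    rw [← hgv, hgd]
    simpa using this
  have h2 : ∑ j, (d ∘ σ) j * w j ≤ p w := by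
    have e : ∑ j, (d ∘ σ) j * w j = g (w ∘ (σ⁻¹ : Equiv.Perm (Fin n))) := by
      rw [hgd, ← Equiv.sum_comp σ (fun j => d j * (w ∘ (σ⁻¹ : Equiv.Perm (Fin n))) j)]
      simp
    rw [e, ← hp σ⁻¹ w]
    exact hgp _
  have h3 : 0 ≤ ∑ j, (d ∘ σ) j * (w j - v j) := by
    -- Any lower bound will do, as it multiplies `∑ (w j - v j) = 0`.
    obtain ⟨c, hc⟩ := (Set.finite_range (d ∘ σ)).bddBelow
    have := mul_sum_le_sum_mul_of_antitone c (d ∘ σ) (fun j => w j - v j) hdσ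
      (fun j => hc ⟨j, rfl⟩) (fun k hk => by
        rw [Finset.sum_sub_distrib]; exact sub_nonneg.mpr (hle k hk))
    rwa [Finset.sum_sub_distrib, heq, sub_self, mul_zero] at this
  simp only [mul_sub, Finset.sum_sub_distrib] at h3
  linarith

/-- If `E D` and `Eᴴ D` have phases `φ` and `ψ`, where `D` is diagonal unitary with phases `θ`,
then `2 θ` is majorized by `φ + ψ`. -/
theorem two_mul_seminorm_le_of_hasPhases {n : ℕ} (p : Seminorm ℝ (Fin n → ℝ))
    (hp : ∀ (σ : Equiv.Perm (Fin n)) v, p (v ∘ σ) = p v) (E : Mat n) {θ φ ψ : Fin n → ℝ}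
    (hθ : ∀ j, |θ j| < Real.pi / 2) (hθm : Antitone θ)
    (hφ : HasPhases (E * diagonal (fun j => exp (θ j * I))) φ)
    (hψ : HasPhases (Eᴴ * diagonal (fun j => exp (θ j * I))) ψ) :
    2 * p θ ≤ p φ + p ψ := by
  have h1 : p ((2 : ℝ) • θ) ≤ p (φ + ψ) := by
    refine seminorm_le_of_majorized p hp (fun i j hij => ?_) (fun k hk => ?_) ?_
    · have := hθm hij
      simp only [Pi.smul_apply, smul_eq_mul]
      linarith
    · obtain ⟨φ', hφ'⟩ := hφ.exists_submatrix hk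
      obtain ⟨ψ', hψ'⟩ := hψ.exists_submatrix hk
      have h := sum_phases_add_sum_phases E hθ hφ hψ k hk φ' ψ' hφ' hψ'
      simp only [Pi.smul_apply, smul_eq_mul, Pi.add_apply, ← Finset.mul_sum, ← h,
        Finset.sum_add_distrib]
      exact add_le_add (Finset.sum_le_sum fun j _ => hφ.submatrix_le hk hφ' j)
        (Finset.sum_le_sum fun j _ => hψ.submatrix_le hk hψ' j)
    · have h := sum_phases_add_sum_phases E hθ hφ hψ n le_rfl φ ψ hφ hψ
      simp only [Pi.smul_apply, smul_eq_mul, Pi.add_apply, ← Finset.mul_sum,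
        Finset.sum_add_distrib]
      exact h.symm
  rw [map_smul_eq_mul, Real.norm_of_nonneg zero_le_two] at h1
  exact h1.trans (map_add_le_add p φ ψ)

/-! ### From midpoint convexity to convexity -/

/-- A midpoint convex function bounded above on an interval is convex. -/
theorem convexOn_Icc_of_midpoint {f : ℝ → ℝ} {a b : ℝ} (C : ℝ) (hC : ∀ t ∈ Set.Icc a b, f t ≤ C)
    (hf : ∀ s ∈ Set.Icc a b, ∀ r ∈ Set.Icc a b, 2 * f ((s + r) / 2) ≤ f s + f r) :
    ConvexOn ℝ (Set.Icc a b) f := by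
  refine ⟨convex_Icc a b, fun s hs r hr α β hα hβ hαβ => ?_⟩
  -- The excess of `f` over its chord. Each `c` is the midpoint of an endpoint, where `q` vanishes,
  -- and another point of `[0, 1]`; hence the supremum satisfies `m ≤ m / 2`.
  set q : ℝ → ℝ := fun c => f ((1 - c) * s + c * r) - ((1 - c) * f s + c * f r) with hq
  have hmem : ∀ c ∈ Set.Icc (0 : ℝ) 1, (1 - c) * s + c * r ∈ Set.Icc a b := fun c hc =>
    convex_Icc a b hs hr (sub_nonneg.mpr hc.2) hc.1 (by ring)
  have hbdd : BddAbove (q '' Set.Icc 0 1) := by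
    refine ⟨C + |f s| + |f r|, ?_⟩
    rintro _ ⟨c, hc, rfl⟩
    have h1 := hC _ (hmem c hc)
    have h3 : -((1 - c) * f s) ≤ |f s| := by
      have h : (1 - c) * -f s ≤ (1 - c) * |f s| :=
        mul_le_mul_of_nonneg_left (neg_le_abs _) (sub_nonneg.mpr hc.2)
      have h' := mul_nonneg hc.1 (abs_nonneg (f s))
      linarith
    have h4 : -(c * f r) ≤ |f r| := by
      have h : c * -f r ≤ c * |f r| := mul_le_mul_of_nonneg_left (neg_le_abs _) hc.1
      have h' := mul_nonneg (sub_nonneg.mpr hc.2) (abs_nonneg (f r))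
      linarith
    simp only [hq]
    linarith
  have hmid : ∀ c ∈ Set.Icc (0 : ℝ) 1, ∀ c' ∈ Set.Icc (0 : ℝ) 1,
      2 * q ((c + c') / 2) ≤ q c + q c' := fun c hc c' hc' => by
    have h := hf _ (hmem c hc) _ (hmem c' hc')
    have e : ((1 - c) * s + c * r + ((1 - c') * s + c' * r)) / 2 =
        (1 - (c + c') / 2) * s + (c + c') / 2 * r := by ring
    rw [e] at h
    simp only [hq]
    linarith
  have h0 : q 0 = 0 := by simp [hq]
  have h1 : q 1 = 0 := by simp [hq]
  set m := sSup (q '' Set.Icc 0 1) with hm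
  have hle : ∀ c ∈ Set.Icc (0 : ℝ) 1, q c ≤ m := fun c hc => le_csSup hbdd ⟨c, hc, rfl⟩
  have hm2 : m ≤ m / 2 := by
    refine csSup_le ⟨_, 0, by simp, rfl⟩ ?_
    rintro _ ⟨c, hc, rfl⟩
    rcases le_total c (1 / 2) with h | h
    · have h2 : 2 * c ∈ Set.Icc (0 : ℝ) 1 := ⟨by linarith [hc.1], by linarith⟩
      have h3 := hmid 0 (by simp) (2 * c) h2
      rw [zero_add, mul_div_cancel_left₀ c two_ne_zero, h0] at h3
      linarith [hle _ h2]
    · have h2 : 2 * c - 1 ∈ Set.Icc (0 : ℝ) 1 := ⟨by linarith, by linarith [hc.2]⟩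
      have h3 := hmid 1 (by simp) (2 * c - 1) h2
      rw [add_sub_cancel, mul_div_cancel_left₀ c two_ne_zero, h1] at h3
      linarith [hle _ h2]
  have hβ1 : β ∈ Set.Icc (0 : ℝ) 1 := ⟨hβ, by linarith⟩
  have := hle β hβ1
  have hα' : 1 - β = α := by linarith
  simp only [hq, hα'] at this
  simp only [smul_eq_mul]
  linarith

/-! ### Unitarily invariant norms and eigenvalues -/

/-- The real linear embedding of diagonal matrices `i diag v` into `u(n)`. -/
noncomputable def diagI (n : ℕ) : (Fin n → ℝ) →ₗ[ℝ] LieU n where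
  toFun v := ⟨diagonal (fun j => I * (v j : ℂ)), by
    rw [skewAdjoint.mem_iff, star_eq_conjTranspose, diagonal_conjTranspose]
    ext i j
    by_cases h : i = j <;> simp [h]⟩
  map_add' v w := by
    ext i j
    by_cases h : i = j <;> simp [h, mul_add]
  map_smul' c v := by
    ext i j
    by_cases h : i = j
    · subst h
      simp
      ring
    · simp [h]

theorem coe_diagI {n : ℕ} (v : Fin n → ℝ) :
    (diagI n v : Mat n) = diagonal (fun j => I * (v j : ℂ)) := rfl

/-- The gauge function on `ℝⁿ` of a seminorm on `u(n)`. -/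
noncomputable def gaugeOf {n : ℕ} (N : Seminorm ℝ (LieU n)) : Seminorm ℝ (Fin n → ℝ) :=
  N.comp (diagI n)

theorem gaugeOf_comp_perm {n : ℕ} {N : Seminorm ℝ (LieU n)} (hN : IsUnitarilyInvariantNorm N)
    (σ : Equiv.Perm (Fin n)) (v : Fin n → ℝ) : gaugeOf N (v ∘ σ) = gaugeOf N v := by
  have hU : ∀ τ : Equiv.Perm (Fin n),
      (1 : Mat n).submatrix τ id ∈ Matrix.unitaryGroup (Fin n) ℂ := fun τ => by
    rw [Matrix.mem_unitaryGroup_iff, star_eq_conjTranspose, conjTranspose_submatrix,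
      conjTranspose_one, submatrix_mul _ _ _ id _ Function.bijective_id |>.symm, Matrix.one_mul,
      submatrix_one_equiv]
  have hV : (1 : Mat n).submatrix id σ ∈ Matrix.unitaryGroup (Fin n) ℂ := by
    have h := Unitary.star_mem (hU σ)
    rwa [star_eq_conjTranspose, conjTranspose_submatrix, conjTranspose_one] at h
  refine hN.invariant _ (hU σ) _ hV _ _ ?_
  have : diagonal (fun j => I * ((v ∘ σ) j : ℂ)) =
      (diagonal (fun j => I * (v j : ℂ))).submatrix σ σ := by
    rw [submatrix_diagonal_equiv]; rfl
  rw [coe_diagI, coe_diagI, this]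
  ext i j
  simp [Matrix.mul_apply, Matrix.one_apply]

theorem mulI_eq_gaugeOf {n : ℕ} {N : Seminorm ℝ (LieU n)} (hN : IsUnitarilyInvariantNorm N)
    (z : selfAdjoint (Mat n)) {U : Mat n} (hU : U ∈ Matrix.unitaryGroup (Fin n) ℂ) {l : Fin n → ℝ}
    (h : (z : Mat n) = U * diagonal (fun j => (l j : ℂ)) * Uᴴ) :
    N (mulI z) = gaugeOf N l := by
  refine hN.invariant U hU Uᴴ (Unitary.star_mem hU) _ _ ?_
  change I • (z : Mat n) = _
  rw [coe_diagI, h, ← Matrix.smul_mul, ← Matrix.mul_smul, ← diagonal_smul]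
  rfl

theorem abs_le_norm_of_eq_conj_diagonal {n : ℕ} {z U : Mat n}
    (hU : U ∈ Matrix.unitaryGroup (Fin n) ℂ) {l : Fin n → ℝ}
    (h : z = U * diagonal (fun j => (l j : ℂ)) * Uᴴ) (j : Fin n) : |l j| ≤ ‖z‖ := by
  have hn : ‖z‖ = ‖fun j => (l j : ℂ)‖ := by
    rw [h, ← star_eq_conjTranspose, CStarRing.norm_mul_mem_unitary _ (Unitary.star_mem hU),
      CStarRing.norm_mem_unitary_mul _ hU, l2_opNorm_diagonal]
  rw [hn]
  simpa using norm_le_pi_norm (fun j => (l j : ℂ)) j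

theorem exp_I_smul_conj_diagonal {n : ℕ} {U : Mat n} (hU : U ∈ Matrix.unitaryGroup (Fin n) ℂ)
    (l : Fin n → ℝ) :
    NormedSpace.exp (I • (U * diagonal (fun j => (l j : ℂ)) * Uᴴ)) =
      U * diagonal (fun j => exp (l j * I)) * Uᴴ := by
  have hUU : U * Uᴴ = 1 := Matrix.mem_unitaryGroup_iff.mp hU
  have hinv : Uᴴ = U⁻¹ := (inv_eq_right_inv hUU).symm
  have hunit : IsUnit U := IsUnit.of_mul_eq_one _ hUU
  rw [hinv, ← Matrix.smul_mul, ← Matrix.mul_smul, Matrix.exp_conj _ _ hunit, ← diagonal_smul,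
    Matrix.exp_diagonal]
  congr 3
  funext j
  rw [Pi.coe_exp, ← Complex.exp_eq_exp_ℂ]
  simp [mul_comm]

/-- For unitary matrices congruence includes conjugation, so eigenvalue arguments in `(-π/2, π/2)`
are phases. -/
theorem hasPhases_of_conj {n : ℕ} {U V A : Mat n} (hU : U ∈ Matrix.unitaryGroup (Fin n) ℂ)
    (hV : V ∈ Matrix.unitaryGroup (Fin n) ℂ) {l : Fin n → ℝ} (hl : Antitone l)
    (hl' : ∀ j, |l j| < Real.pi / 2) (hA : A = V * diagonal (fun j => exp (l j * I)) * Vᴴ) :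
    HasPhases (Uᴴ * A * U) l := by
  refine ⟨hl, hl', Vᴴ * U, ?_, ?_⟩
  · have h := mul_mem (Unitary.star_mem hV) hU
    exact (Matrix.isUnit_iff_isUnit_det _).mp
      (IsUnit.of_mul_eq_one _ (Matrix.mem_unitaryGroup_iff.mp h))
  · rw [hA, conjTranspose_mul, conjTranspose_conjTranspose]
    simp only [Matrix.mul_assoc]

/-! ### The midpoint inequality and the theorem -/

/-- If `exp (i a) = E exp (i z)` and `exp (i b) = Eᴴ exp (i z)`, where the spectra of `a`, `b` and
`z` lie in `(-π/2, π/2)`, then the norm of `z` is at most the mean of the norms of `a` and `b`. -/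
theorem two_mul_norm_le {n : ℕ} {N : Seminorm ℝ (LieU n)} (hN : IsUnitarilyInvariantNorm N)
    (a b z : selfAdjoint (Mat n)) (E : Mat n)
    (ha : ‖(a : Mat n)‖ < Real.pi / 2) (hb : ‖(b : Mat n)‖ < Real.pi / 2)
    (hz : ‖(z : Mat n)‖ < Real.pi / 2)
    (hEa : NormedSpace.exp (I • (a : Mat n)) = E * NormedSpace.exp (I • (z : Mat n)))
    (hEb : NormedSpace.exp (I • (b : Mat n)) = Eᴴ * NormedSpace.exp (I • (z : Mat n))) :
    2 * N (mulI z) ≤ N (mulI a) + N (mulI b) := by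
  obtain ⟨U, hU, θ, hθ, hz'⟩ := exists_antitone_eigenvalues (M := (z : Mat n)) z.2
  obtain ⟨V, hV, φ, hφ, ha'⟩ := exists_antitone_eigenvalues (M := (a : Mat n)) a.2
  obtain ⟨W, hW, ψ, hψ, hb'⟩ := exists_antitone_eigenvalues (M := (b : Mat n)) b.2
  rw [mulI_eq_gaugeOf hN z hU hz', mulI_eq_gaugeOf hN a hV ha', mulI_eq_gaugeOf hN b hW hb']
  have hUU : Uᴴ * U = 1 := Matrix.mem_unitaryGroup_iff'.mp hU
  have conj : ∀ G : Mat n, Uᴴ * (G * NormedSpace.exp (I • (z : Mat n))) * U =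
      Uᴴ * G * U * diagonal (fun j => exp (θ j * I)) := fun G => by
    rw [hz', exp_I_smul_conj_diagonal hU]
    simp only [Matrix.mul_assoc, hUU, Matrix.mul_one]
  refine two_mul_seminorm_le_of_hasPhases (gaugeOf N) (gaugeOf_comp_perm hN) (Uᴴ * E * U)
    (fun j => (abs_le_norm_of_eq_conj_diagonal hU hz' j).trans_lt hz) hθ ?_ ?_
  · rw [← conj, ← hEa]
    exact hasPhases_of_conj hU hV hφ (fun j => (abs_le_norm_of_eq_conj_diagonal hV ha' j).trans_lt ha)
      (by rw [← exp_I_smul_conj_diagonal hV, ← ha'])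
  · rw [conjTranspose_mul, conjTranspose_mul, conjTranspose_conjTranspose, ← Matrix.mul_assoc,
      ← conj, ← hEb]
    exact hasPhases_of_conj hU hW hψ (fun j => (abs_le_norm_of_eq_conj_diagonal hW hb' j).trans_lt hb)
      (by rw [← exp_I_smul_conj_diagonal hW, ← hb'])

/-- Supplies the upper bound needed to pass from midpoint convexity to convexity. -/
theorem mulI_le_of_norm_lt {n : ℕ} {N : Seminorm ℝ (LieU n)} (hN : IsUnitarilyInvariantNorm N)
    (z : selfAdjoint (Mat n)) {c : ℝ} (hz : ‖(z : Mat n)‖ < c) :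
    N (mulI z) ≤ ∑ j, c * gaugeOf N (Pi.single j 1) := by
  obtain ⟨U, hU, θ, -, hz'⟩ := exists_antitone_eigenvalues (M := (z : Mat n)) z.2
  rw [mulI_eq_gaugeOf hN z hU hz']
  conv_lhs => rw [← Finset.univ_sum_single θ]
  refine (Finset.le_sum_of_subadditive (gaugeOf N) (map_zero _).le
    (fun x y => map_add_le_add _ x y) _ _).trans (Finset.sum_le_sum fun j _ => ?_)
  rw [← mul_one (θ j), ← smul_eq_mul, Pi.single_smul, map_smul_eq_mul, Real.norm_eq_abs]
  exact mul_le_mul_of_nonneg_right ((abs_le_norm_of_eq_conj_diagonal hU hz' j).trans hz.le)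
    (apply_nonneg _ _)

end UnitaryConvexity

theorem theorem4p2 (n : ℕ) (N : Seminorm ℝ (UnitaryConvexity.LieU n))
    (hN : UnitaryConvexity.IsUnitarilyInvariantNorm N)
    (x y : selfAdjoint (UnitaryConvexity.Mat n)) (t₁ t₂ : ℝ)
    (z : ℝ → selfAdjoint (UnitaryConvexity.Mat n))
    (hexp : ∀ t ∈ Set.Icc t₁ t₂,
      NormedSpace.exp (Complex.I • (z t : UnitaryConvexity.Mat n)) =
        NormedSpace.exp ((Complex.I * (t : ℂ)) • (x : UnitaryConvexity.Mat n)) *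
          NormedSpace.exp (Complex.I • (y : UnitaryConvexity.Mat n)))
    (hz : ∀ t ∈ Set.Icc t₁ t₂, ‖(z t : UnitaryConvexity.Mat n)‖ < Real.pi / 2) :
    ConvexOn ℝ (Set.Icc t₁ t₂) (fun t => N (UnitaryConvexity.mulI (z t))) := by
  refine UnitaryConvexity.convexOn_Icc_of_midpoint _
    (fun t ht => UnitaryConvexity.mulI_le_of_norm_lt hN (z t) (hz t ht)) fun s hs r hr => ?_
  have ht : (s + r) / 2 ∈ Set.Icc t₁ t₂ := ⟨by linarith [hs.1, hr.1], by linarith [hs.2, hr.2]⟩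
  set E : ℝ → UnitaryConvexity.Mat n := fun h =>
    NormedSpace.exp ((Complex.I * (h : ℂ)) • (x : UnitaryConvexity.Mat n)) with hE
  have hadd : ∀ h t, E (h + t) = E h * E t := fun h t => by
    simp only [hE]
    rw [← Matrix.exp_add_of_commute _ _ (((Commute.refl _).smul_left _).smul_right _), ← add_smul,
      ← mul_add, Complex.ofReal_add]
  have hstar : ∀ h, E (-h) = (E h).conjTranspose := fun h => by
    have hx : (x : UnitaryConvexity.Mat n).conjTranspose = x := x.2
    simp only [hE]
    rw [← Matrix.exp_conjTranspose, Matrix.conjTranspose_smul, hx]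
    simp
  refine UnitaryConvexity.two_mul_norm_le hN (z s) (z r) (z ((s + r) / 2)) (E ((s - r) / 2))
    (hz s hs) (hz r hr) (hz _ ht) ?_ ?_
  -- `s` and `r` are `(s + r) / 2 ± (s - r) / 2`, and `E (-h)` is the adjoint of `E h`.
  · rw [hexp s hs, hexp _ ht, ← Matrix.mul_assoc]
    change E s * _ = E _ * E _ * _
    rw [← hadd]
    congr 2
    ring
  · rw [hexp r hr, hexp _ ht, ← Matrix.mul_assoc, ← hstar]
    change E r * _ = E _ * E _ * _
    rw [← hadd]
    congr 2
    ring
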